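/- Let $K$ be a number field with ring of integers $R$ and let $L/K$ be a quadratic field extension. Let $J$ be a full $R$-lattice in $L$, i.e. an $R$-submodule $J\subseteq L$ such that $J\subseteq Rx_1+Rx_2$ for some $K$-basis $x_1,x_2$ of $L$ and such that $J$ spans $L$ over $K$ (equivalently, $J\otimes_R K=L$). Let $x_0\in L\setminus K$ be arbitrary and put $$\mathfrak a=\{k\in K : kx_0\in J+K\}.$$ Then $J\cong R\oplus \mathfrak a\cdot(J\cap K)$ as $R$-modules, and $J$ is free as an $R$-module if and only if $\mathfrak a\cdot(J\cap K)$ is a principal fractional ideal of $R$, i.e. equal to $Rc$ for some $c\in K^\times$. -/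

import Mathlib

open scoped NumberField

/-- `J` is a full lattice in the finite-dimensional `K`-space `V` with respect to `R`: it is
contained in `R x₁ + ⋯ + R xₙ` for some `K`-basis `x₁, …, xₙ` of `V`, and it spans `V` over `K`
(that is, the canonical map `J ⊗[R] K → V` is onto; it is always injective when `K` is the field
of fractions of `R`). -/
structure IsFullLattice {R V : Type*} (K : Type*) [CommRing R] [Field K] [AddCommGroup V]
    [Module K V] [Module R V] (J : Submodule R V) : Prop where
  exists_basis_le : ∃ x : Module.Basis (Fin (Module.finrank K V)) K V,
    J ≤ Submodule.span R (Set.range x)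
  span_eq_top : Submodule.span K (J : Set V) = ⊤

/-- A principal fractional ideal: an `R`-submodule of `K` of the form `R c` with `c ≠ 0`. -/
def IsPrincipalFractionalIdeal {R K : Type*} [CommRing R] [Field K] [Algebra R K]
    (I : Submodule R K) : Prop :=
  ∃ c : K, c ≠ 0 ∧ I = Submodule.span R {c}

section

variable {R K L : Type*} [CommRing R] [Field K] [Field L] [Algebra R K] [Algebra K L]
  [Algebra R L] [IsScalarTower R K L]

variable (R K L) in
/-- The image of `K` in `L`, as an `R`-submodule of `L`. -/
def baseFieldSubmodule : Submodule R L :=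
  (LinearMap.range (Algebra.linearMap K L)).restrictScalars R

variable (K) in
/-- `J ∩ K`, as an `R`-submodule of `K`. -/
def interBase (J : Submodule R L) : Submodule R K where
  carrier := {k | algebraMap K L k ∈ J}
  zero_mem' := by simp
  add_mem' := fun {a b} ha hb => by
    simpa using J.add_mem ha hb
  smul_mem' := fun r a ha => by
    simpa [Algebra.algebraMap_eq_smul_one] using J.smul_mem r ha

variable (K) in
/-- The coefficient `𝔞 = {k ∈ K : k x₀ ∈ J + K}`, as an `R`-submodule of `K`. -/
def coeffModBase (J : Submodule R L) (x₀ : L) : Submodule R K where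
  carrier := {k | k • x₀ ∈ J ⊔ baseFieldSubmodule R K L}
  zero_mem' := by simp
  add_mem' := fun {a b} ha hb => by
    simpa [add_smul] using Submodule.add_mem _ ha hb
  smul_mem' := fun r a ha => by
    simpa using Submodule.smul_mem _ r ha

end

/-!
The coordinate along `x₀` in the basis `1, x₀` of `L` has kernel `K` and maps `J` onto `𝔞`, which is
projective because `R` is Dedekind, so `J ≅ 𝔞 ⊕ (J ∩ K)`. Steinitz's isomorphism
`I ⊕ I' ≅ R ⊕ I I'` then gives the first claim: after rescaling, `I + I' = R`, so
`0 → I ∩ I' → I ⊕ I' → R → 0` splits, and `I ∩ I' = I I'` by comaximality. A free `J` has rank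
two, and a surjection `R² → R ⊕ M` forces `M` to be cyclic, generated by a determinant.
-/

open Function
open scoped nonZeroDivisors

section ExactSequences

variable {R M N P : Type*} [CommRing R] [AddCommGroup M] [Module R M] [AddCommGroup N] [Module R N]
  [AddCommGroup P] [Module R P]

theorem nonempty_linearEquiv_prod_of_exact [Module.Projective R P] {f : M →ₗ[R] N} {g : N →ₗ[R] P}
    (hfg : Exact f g) (hf : Injective f) (hg : Surjective g) : Nonempty (N ≃ₗ[R] M × P) := by
  obtain ⟨s, hs⟩ := g.exists_rightInverse_of_surjective (LinearMap.range_eq_top.2 hg)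
  exact ⟨(hfg.splitSurjectiveEquiv hf ⟨s, hs⟩).1⟩

theorem nonempty_linearEquiv_comap_prod_map {f : M →ₗ[R] N} {g : N →ₗ[R] P} (hfg : Exact f g)
    (hf : Injective f) (J : Submodule R N) [Module.Projective R (J.map g)] :
    Nonempty (J ≃ₗ[R] J.comap f × J.map g) := by
  refine nonempty_linearEquiv_prod_of_exact (f := f.submoduleComap J) (g := g.submoduleMap J)
    (fun y => ?_) (fun x y hxy => Subtype.ext (hf (congrArg Subtype.val hxy)))
    (g.submoduleMap_surjective J)
  constructor
  · intro hy
    obtain ⟨x, hx⟩ := (hfg y).1 (congrArg Subtype.val hy)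
    exact ⟨⟨x, show f x ∈ J from hx ▸ y.2⟩, Subtype.ext hx⟩
  · rintro ⟨x, rfl⟩
    exact Subtype.ext (hfg.apply_apply_eq_zero x)

theorem nonempty_prod_linearEquiv_inf_prod_sup (p q : Submodule R M)
    [Module.Projective R ↥(p ⊔ q)] : Nonempty ((p × q) ≃ₗ[R] ↥(p ⊓ q) × ↥(p ⊔ q)) := by
  let diag : ↥(p ⊓ q) →ₗ[R] p × q :=
    (Submodule.inclusion inf_le_left).prod (Submodule.inclusion inf_le_right)
  let diff : p × q →ₗ[R] ↥(p ⊔ q) :=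
    (Submodule.inclusion le_sup_left).coprod (-Submodule.inclusion le_sup_right)
  have diff_coe (z : p × q) : (diff z : M) = z.1 - z.2 := by simp [diff, sub_eq_add_neg]
  refine nonempty_linearEquiv_prod_of_exact (f := diag) (g := diff) (fun z => ?_)
    (fun x y hxy => Subtype.ext (congrArg (fun z : p × q => (z.1 : M)) hxy)) ?_
  · rw [← Submodule.coe_eq_zero, diff_coe, sub_eq_zero]
    constructor
    · intro hz
      exact ⟨⟨z.1, z.1.2, hz ▸ z.2.2⟩, Prod.ext rfl (Subtype.ext hz)⟩
    · rintro ⟨x, rfl⟩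
      rfl
  · rintro ⟨m, hm⟩
    obtain ⟨a, ha, b, hb, rfl⟩ := Submodule.mem_sup.1 hm
    exact ⟨(⟨a, ha⟩, -⟨b, hb⟩), Subtype.ext (by simp [diff_coe])⟩

/- If `(a, m)` and `(c, n)` are the images of the standard basis vectors, then `M` is generated by
the determinant `a n - c m`: apply Cramer's rule to preimages of `(1, 0)` and `(0, i)`. -/
theorem isPrincipal_of_surjective {f : R × R →ₗ[R] R × M} (hf : Surjective f) :
    Module.IsPrincipal R M := by
  obtain ⟨a, m, ham⟩ : ∃ a m, f (1, 0) = (a, m) := ⟨_, _, rfl⟩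
  obtain ⟨c, n, hcn⟩ : ∃ c n, f (0, 1) = (c, n) := ⟨_, _, rfl⟩
  have f_apply (p q : R) : f (p, q) = (p * a + q * c, p • m + q • n) := by
    have hpq : ((p, q) : R × R) = p • (1, 0) + q • (0, 1) := by simp
    rw [hpq, map_add, map_smul, map_smul, ham, hcn]
    rfl
  refine ⟨a • n - c • m, (eq_top_iff.2 fun i _ => Submodule.mem_span_singleton.2 ?_).symm⟩
  obtain ⟨⟨p, q⟩, hpq⟩ := hf (1, 0)
  obtain ⟨⟨r, s⟩, hrs⟩ := hf (0, i)
  rw [f_apply, Prod.mk.injEq] at hpq hrs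
  refine ⟨p * s - q * r, ?_⟩
  linear_combination (norm := module) hpq.1 • (r • m + s • n) - hrs.1 • (p • m + q • n) + hrs.2

end ExactSequences

section SubmoduleProducts

variable {R A : Type*} [CommRing R] [CommRing A] [Algebra R A] (I J : Submodule R A)

theorem nonempty_linearEquiv_span_singleton_mul {c : A} (hc : IsLeftRegular c) :
    Nonempty (I ≃ₗ[R] ↥(Submodule.span R {c} * I)) := by
  have hmap : I.map (LinearMap.mulLeft R c) = Submodule.span R {c} * I := by
    ext
    simp [Submodule.mem_span_singleton_mul]
  exact ⟨(Submodule.equivMapOfInjective _ hc I).trans (LinearEquiv.ofEq _ _ hmap)⟩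

variable {I J}

theorem inf_eq_mul_of_sup_eq_one (h : I ⊔ J = 1) : I ⊓ J = I * J := by
  have hI : I ≤ 1 := h ▸ le_sup_left
  have hJ : J ≤ 1 := h ▸ le_sup_right
  refine le_antisymm ?_ (le_inf (mul_le_of_le_one_right' hJ) (mul_le_of_le_one_left' hI))
  calc I ⊓ J = (I ⊓ J) * I ⊔ (I ⊓ J) * J := by rw [← Submodule.mul_sup, h, mul_one]
    _ ≤ J * I ⊔ I * J := sup_le_sup (mul_le_mul_left inf_le_right I) (mul_le_mul_left inf_le_left J)
    _ = I * J := by rw [mul_comm, sup_idem]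

theorem nonempty_prod_linearEquiv_prod_mul_of_sup_eq_one [FaithfulSMul R A] (h : I ⊔ J = 1) :
    Nonempty ((I × J) ≃ₗ[R] R × ↥(I * J)) := by
  let sup_equiv : ↥(I ⊔ J) ≃ₗ[R] R :=
    (LinearEquiv.ofEq _ _ (h.trans Submodule.one_eq_range)).trans
      (LinearEquiv.ofInjective _ (FaithfulSMul.algebraMap_injective R A)).symm
  have := Module.Projective.of_equiv sup_equiv.symm
  obtain ⟨e⟩ := nonempty_prod_linearEquiv_inf_prod_sup I J
  exact ⟨e.trans ((LinearEquiv.prodComm R _ _).trans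
    (sup_equiv.prodCongr (LinearEquiv.ofEq _ _ (inf_eq_mul_of_sup_eq_one h))))⟩

end SubmoduleProducts

section FractionalIdeals

variable {R K : Type*} [CommRing R] [IsDedekindDomain R] [Field K] [Algebra R K]
  [IsFractionRing R K]

open FractionalIdeal IsDedekindDomain

theorem projective_coe_of_ne_zero {I : FractionalIdeal R⁰ K} (hI : I ≠ 0) :
    Module.Projective R (I : Submodule R K) :=
  Submodule.projective_of_isUnit (hI.isUnit.map (coeSubmoduleHom R⁰ K))

theorem exists_spanSingleton_mul_add_spanSingleton_mul_eq_one {I J : FractionalIdeal R⁰ K}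
    (hI : I ≠ 0) (hJ : J ≠ 0) :
    ∃ u v : K, u ≠ 0 ∧ v ≠ 0 ∧ spanSingleton R⁰ u * I + spanSingleton R⁰ v * J = 1 := by
  have den_ne_zero (A : FractionalIdeal R⁰ K) : algebraMap R K A.den ≠ 0 := by simp
  have hnum : (J.num : FractionalIdeal R⁰ K) ≠ 0 := by simpa using num_eq_zero_iff.not.2 hJ
  obtain ⟨x, hx⟩ := exists_add_spanSingleton_mul_eq coeIdeal_le_one hnum hI
  rcases eq_or_ne x 0 with rfl | hx₀
  · refine ⟨_, _, den_ne_zero I, den_ne_zero J, ?_⟩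
    have hnum_one : (J.num : FractionalIdeal R⁰ K) = 1 := by simpa using hx
    rw [den_mul_self_eq_num', den_mul_self_eq_num', hnum_one, ← sup_eq_add]
    exact sup_eq_right.2 coeIdeal_le_one
  · exact ⟨x, _, hx₀, den_ne_zero J, by rw [den_mul_self_eq_num', add_comm, hx]⟩

theorem nonempty_prod_linearEquiv_prod_mul {I J : FractionalIdeal R⁰ K} (hI : I ≠ 0) (hJ : J ≠ 0) :
    Nonempty ((I × J) ≃ₗ[R] R × ↥(I * J : Submodule R K)) := by
  obtain ⟨u, v, hu, hv, h⟩ := exists_spanSingleton_mul_add_spanSingleton_mul_eq_one hI hJ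
  have hsup : Submodule.span R {u} * I ⊔ Submodule.span R {v} * J = (1 : Submodule R K) := by
    simpa using congrArg (coeSubmoduleHom R⁰ K) h
  have hmul : Submodule.span R {u} * I * (Submodule.span R {v} * J) =
      Submodule.span R {u * v} * (I * J : Submodule R K) := by
    rw [mul_mul_mul_comm, Submodule.span_mul_span, Set.singleton_mul_singleton]
  obtain ⟨e⟩ := nonempty_prod_linearEquiv_prod_mul_of_sup_eq_one hsup
  obtain ⟨eI⟩ := nonempty_linearEquiv_span_singleton_mul (I : Submodule R K)
    (IsRegular.of_ne_zero hu).left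
  obtain ⟨eJ⟩ := nonempty_linearEquiv_span_singleton_mul (J : Submodule R K)
    (IsRegular.of_ne_zero hv).left
  obtain ⟨eIJ⟩ := nonempty_linearEquiv_span_singleton_mul (I * J : Submodule R K)
    (IsRegular.of_ne_zero (mul_ne_zero hu hv)).left
  exact ⟨(eI.prodCongr eJ).trans (e.trans ((LinearEquiv.refl R R).prodCongr
    ((LinearEquiv.ofEq _ _ hmul).trans eIJ.symm)))⟩

end FractionalIdeals

section Lattices

variable {R K V : Type*} [CommRing R] [Field K] [Algebra R K] [AddCommGroup V] [Module K V]
  [Module R V] [IsScalarTower R K V] {J : Submodule R V}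

theorem IsFullLattice.isLattice [IsNoetherianRing R] (hJ : IsFullLattice K J) :
    Submodule.IsLattice K J where
  fg := by
    obtain ⟨x, hx⟩ := hJ.exists_basis_le
    have := isNoetherian_span_of_finite R (Set.finite_range x)
    have := isNoetherian_of_le hx
    exact Module.Finite.iff_fg.1 inferInstance
  span_eq_top := hJ.span_eq_top

theorem IsFullLattice.exists_ne_zero_smul_mem [IsFractionRing R K] (hJ : IsFullLattice K J)
    (y : V) : ∃ k : K, k ≠ 0 ∧ k • y ∈ J := by
  obtain ⟨r, hr⟩ := multiple_mem_span_of_mem_localization_span R⁰ K (J : Set V) y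
    (hJ.span_eq_top ▸ Submodule.mem_top)
  refine ⟨algebraMap R K r, (IsLocalization.map_units K r).ne_zero, ?_⟩
  rwa [algebraMap_smul, ← Submodule.span_eq J]

theorem IsFullLattice.nonempty_linearEquiv_fun [IsNoetherianRing R] [IsFractionRing R K]
    [Module.Free R J] (hJ : IsFullLattice K J) :
    Nonempty (J ≃ₗ[R] (Fin (Module.finrank K V) → R)) := by
  have := hJ.isLattice
  obtain ⟨x, -⟩ := hJ.exists_basis_le
  let b := Module.Free.chooseBasis R J
  exact ⟨(b.reindex ((b.extendOfIsLattice K).indexEquiv x)).equivFun⟩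

end Lattices

section BaseField

variable {R K L : Type*} [CommRing R] [Field K] [Field L] [Algebra R K] [Algebra K L]
  [Algebra R L] [IsScalarTower R K L] {J : Submodule R L}

theorem coeffModBase_eq_map {f : L →ₗ[K] K} (hf : Exact (Algebra.linearMap K L) f) {x₀ : L}
    (hfx₀ : f x₀ = 1) : coeffModBase K J x₀ = J.map (f.restrictScalars R) := by
  ext k
  change k • x₀ ∈ J ⊔ baseFieldSubmodule R K L ↔ _
  rw [Submodule.mem_sup, Submodule.mem_map]
  constructor
  · rintro ⟨j, hj, _, ⟨a, rfl⟩, h⟩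
    have hfa : f (algebraMap K L a) = 0 := hf.apply_apply_eq_zero a
    exact ⟨j, hj, by simpa [hfa, hfx₀] using congrArg f h⟩
  · rintro ⟨j, hj, rfl⟩
    obtain ⟨a, ha⟩ := (hf (f j • x₀ - j)).1 (by simp [hfx₀])
    exact ⟨j, hj, _, ⟨a, rfl⟩, by simp [ha]⟩

theorem exists_exact_linearMap_apply_eq_one [Algebra.IsQuadraticExtension K L] {x₀ : L}
    (hx₀ : x₀ ∉ Set.range (algebraMap K L)) :
    ∃ f : L →ₗ[K] K, Exact (Algebra.linearMap K L) f ∧ f x₀ = 1 := by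
  have hli : LinearIndependent K ![(1 : L), x₀] := by
    rw [LinearIndependent.pair_iff' one_ne_zero]
    rintro a rfl
    exact hx₀ ⟨a, Algebra.algebraMap_eq_smul_one a⟩
  let b := basisOfLinearIndependentOfCardEqFinrank hli
    (by simp [Algebra.IsQuadraticExtension.finrank_eq_two K L])
  have hb₀ : b 0 = 1 := by simp [b]
  have hb₁ : b 1 = x₀ := by simp [b]
  refine ⟨b.coord 1, fun y => ⟨fun hy => ⟨b.repr y 0, ?_⟩, ?_⟩, by simp [← hb₁]⟩
  · rw [Module.Basis.coord_apply] at hy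
    have hsum := b.sum_repr y
    rw [Fin.sum_univ_two, hb₀, hy, zero_smul, add_zero] at hsum
    rwa [Algebra.linearMap_apply, Algebra.algebraMap_eq_smul_one]
  · rintro ⟨k, rfl⟩
    simp [Algebra.algebraMap_eq_smul_one, ← hb₀]

theorem IsFullLattice.interBase_ne_bot [IsFractionRing R K] (hJ : IsFullLattice K J) :
    interBase K J ≠ ⊥ := by
  obtain ⟨k, hk, hkJ⟩ := hJ.exists_ne_zero_smul_mem (1 : L)
  rw [← Algebra.algebraMap_eq_smul_one] at hkJ
  exact (Submodule.ne_bot_iff _).2 ⟨k, hkJ, hk⟩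

theorem IsFullLattice.coeffModBase_ne_bot [IsFractionRing R K] (hJ : IsFullLattice K J) (x₀ : L) :
    coeffModBase K J x₀ ≠ ⊥ := by
  obtain ⟨k, hk, hkJ⟩ := hJ.exists_ne_zero_smul_mem x₀
  exact (Submodule.ne_bot_iff _).2 ⟨k, Submodule.mem_sup_left hkJ, hk⟩

theorem IsFullLattice.fg_interBase [IsNoetherianRing R] (hJ : IsFullLattice K J) :
    (interBase K J).FG := by
  have := hJ.isLattice
  let ι := (Algebra.linearMap K L).restrictScalars R
  have hι : Injective (ι.submoduleComap J) := fun a b hab =>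
    Subtype.ext ((algebraMap K L).injective (congrArg Subtype.val hab))
  have : IsNoetherian R (interBase K J) := isNoetherian_of_injective _ hι
  exact Module.Finite.iff_fg.1 inferInstance

variable [Algebra.IsQuadraticExtension K L] {x₀ : L}

theorem IsFullLattice.fg_coeffModBase [IsNoetherianRing R] (hJ : IsFullLattice K J)
    (hx₀ : x₀ ∉ Set.range (algebraMap K L)) : (coeffModBase K J x₀).FG := by
  obtain ⟨f, hf, hfx₀⟩ := exists_exact_linearMap_apply_eq_one hx₀
  rw [coeffModBase_eq_map hf hfx₀]
  exact hJ.isLattice.fg.map _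

variable [IsDedekindDomain R] [IsFractionRing R K]

theorem IsFullLattice.nonempty_linearEquiv_prod_mul (hJ : IsFullLattice K J)
    (hx₀ : x₀ ∉ Set.range (algebraMap K L)) :
    Nonempty (J ≃ₗ[R] R × ↥(coeffModBase K J x₀ * interBase K J)) := by
  let A : FractionalIdeal R⁰ K := ⟨_, FractionalIdeal.isFractional_of_fg (hJ.fg_coeffModBase hx₀)⟩
  let B : FractionalIdeal R⁰ K := ⟨_, FractionalIdeal.isFractional_of_fg hJ.fg_interBase⟩
  have hA : A ≠ 0 := FractionalIdeal.coeToSubmodule_ne_bot.1 (hJ.coeffModBase_ne_bot x₀)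
  have hB : B ≠ 0 := FractionalIdeal.coeToSubmodule_ne_bot.1 hJ.interBase_ne_bot
  obtain ⟨f, hf, hfx₀⟩ := exists_exact_linearMap_apply_eq_one hx₀
  have hmap : J.map (f.restrictScalars R) = A := (coeffModBase_eq_map hf hfx₀).symm
  have : Module.Projective R (J.map (f.restrictScalars R)) := hmap ▸ projective_coe_of_ne_zero hA
  obtain ⟨split⟩ := nonempty_linearEquiv_comap_prod_map
    (f := (Algebra.linearMap K L).restrictScalars R) (g := f.restrictScalars R) hf
    (algebraMap K L).injective J
  obtain ⟨steinitz⟩ := nonempty_prod_linearEquiv_prod_mul hA hB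
  exact ⟨(split.trans (LinearEquiv.prodComm R _ _)).trans
    (((LinearEquiv.ofEq _ _ hmap).prodCongr (LinearEquiv.refl R B)).trans steinitz)⟩

theorem IsFullLattice.free_iff_isPrincipalFractionalIdeal (hJ : IsFullLattice K J)
    (hx₀ : x₀ ∉ Set.range (algebraMap K L)) :
    Module.Free R J ↔ IsPrincipalFractionalIdeal (coeffModBase K J x₀ * interBase K J) := by
  obtain ⟨e⟩ := hJ.nonempty_linearEquiv_prod_mul hx₀
  constructor
  · intro _
    obtain ⟨b⟩ := hJ.nonempty_linearEquiv_fun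
    rw [Algebra.IsQuadraticExtension.finrank_eq_two] at b
    let e' := (LinearEquiv.finTwoArrow R R).symm.trans (b.symm.trans e)
    obtain ⟨c, hc⟩ := Module.isPrincipal_submodule_iff.1
      (isPrincipal_of_surjective (f := e'.toLinearMap) e'.surjective)
    refine ⟨c, ?_, hc⟩
    rintro rfl
    rw [Submodule.span_zero_singleton] at hc
    exact mul_ne_zero (hJ.coeffModBase_ne_bot x₀) hJ.interBase_ne_bot hc
  · rintro ⟨c, hc, h⟩
    rw [h] at e
    exact Module.Free.of_equiv (e.trans ((LinearEquiv.refl R R).prodCongr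
      (LinearEquiv.toSpanNonzeroSingleton R K c hc).symm)).symm

end BaseField

theorem corollary27_general {R K L : Type*} [CommRing R] [IsDedekindDomain R] [Field K] [Field L]
    [Algebra R K] [IsFractionRing R K] [Algebra K L] [Algebra R L] [IsScalarTower R K L]
    [Algebra.IsQuadraticExtension K L] {J : Submodule R L} (hJ : IsFullLattice K J)
    {x₀ : L} (hx₀ : x₀ ∉ Set.range (algebraMap K L)) :
    Nonempty (J ≃ₗ[R] R × ↥(coeffModBase K J x₀ * interBase K J)) ∧
    (Module.Free R J ↔ IsPrincipalFractionalIdeal (coeffModBase K J x₀ * interBase K J)) :=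
  ⟨hJ.nonempty_linearEquiv_prod_mul hx₀, hJ.free_iff_isPrincipalFractionalIdeal hx₀⟩

theorem corollary27 (K L : Type*) [Field K] [NumberField K] [Field L] [Algebra K L]
    [Algebra.IsQuadraticExtension K L]
    (J : Submodule (𝓞 K) L) (hJ : IsFullLattice K J)
    (x₀ : L) (hx₀ : x₀ ∉ Set.range (algebraMap K L)) :
    Nonempty (J ≃ₗ[𝓞 K] 𝓞 K × ↥(coeffModBase K J x₀ * interBase K J)) ∧
    (Module.Free (𝓞 K) J ↔
      IsPrincipalFractionalIdeal (coeffModBase K J x₀ * interBase K J)) :=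
  corollary27_general hJ hx₀
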